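/- Let $z = x+iy$ be a point of the upper half-plane ($y>0$). Put $$D_{1,1,1}(z)=\sum_{\substack{\omega_1,\omega_2,\omega_3\in(\mathbb{Z}z+\mathbb{Z})\setminus\{0\}\\ \omega_1+\omega_2+\omega_3=0}}\frac{y^3}{|\omega_1\omega_2\omega_3|^2},\qquad E(z,s)=\frac12\sum_{(m,n)\in\mathbb{Z}^2\setminus\{(0,0)\}}\frac{y^s}{|mz+n|^{2s}},$$ the first sum being over ordered triples. Then the series defining $D_{1,1,1}(z)$ and $E(z,3)$ converge absolutely, and $$D_{1,1,1}(z)=2E(z,3)+\pi^3\zeta(3),$$ where $\zeta$ is the Riemann zeta function. More precisely, in the sum defining $D_{1,1,1}(z)$, the triples $(\omega_1,\omega_2,\omega_3)$ whose three vectors lie on one real line through the origin contribute exactly $2E(z,3)$, and the remaining (non-collinear) triples contribute exactly $\pi^3\zeta(3)$. -/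

import Mathlib

noncomputable section

namespace LatticeSum

/-- The lattice `ℤ z + ℤ` in `ℂ` attached to a point `z` of the upper half-plane. -/
def lattice (z : UpperHalfPlane) : Set ℂ :=
  {ω : ℂ | ∃ m n : ℤ, ω = (m : ℂ) * (z : ℂ) + (n : ℂ)}

/-- Ordered triples of nonzero vectors of `ℤ z + ℤ` whose sum is zero. -/
def triples (z : UpperHalfPlane) : Set (ℂ × ℂ × ℂ) :=
  {t | (t.1 ∈ lattice z ∧ t.2.1 ∈ lattice z ∧ t.2.2 ∈ lattice z) ∧
    (t.1 ≠ 0 ∧ t.2.1 ≠ 0 ∧ t.2.2 ≠ 0) ∧ t.1 + t.2.1 + t.2.2 = 0}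

/-- The three vectors lie on one real line through the origin. -/
def IsCollinear (t : ℂ × ℂ × ℂ) : Prop :=
  Collinear ℝ ({0, t.1, t.2.1, t.2.2} : Set ℂ)

/-- The triples whose three vectors are collinear. -/
def collinearTriples (z : UpperHalfPlane) : Set (ℂ × ℂ × ℂ) :=
  {t | t ∈ triples z ∧ IsCollinear t}

/-- The triples whose three vectors are not collinear. -/
def nonCollinearTriples (z : UpperHalfPlane) : Set (ℂ × ℂ × ℂ) :=
  {t | t ∈ triples z ∧ ¬ IsCollinear t}

/-- The summand `y³ / |ω₁ ω₂ ω₃|²`, where `y = Im z`. -/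
def term (z : UpperHalfPlane) (t : ℂ × ℂ × ℂ) : ℝ :=
  z.im ^ 3 / ‖t.1 * t.2.1 * t.2.2‖ ^ 2

/-- `D_{1,1,1}(z)`: the sum of `y³ / |ω₁ ω₂ ω₃|²` over all triples. -/
def D111 (z : UpperHalfPlane) : ℝ :=
  ∑' t : triples z, term z (t : ℂ × ℂ × ℂ)

/-- The summand `y^s / |m z + n|^(2 s)` of the Eisenstein series, at `p = (m, n)`. -/
def eisensteinTerm (z : UpperHalfPlane) (s : ℂ) (p : ℤ × ℤ) : ℂ :=
  (z.im : ℂ) ^ s / ((‖(p.1 : ℂ) * (z : ℂ) + (p.2 : ℂ)‖ : ℝ) : ℂ) ^ (2 * s)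

/-- The non-holomorphic Eisenstein series
`E(z, s) = (1/2) ∑ y^s / |m z + n|^(2 s)`, over `(m, n) ≠ (0, 0)`. -/
def eisenstein (z : UpperHalfPlane) (s : ℂ) : ℂ :=
  (1 / 2) * ∑' p : {p : ℤ × ℤ // p ≠ (0, 0)}, eisensteinTerm z s (p : ℤ × ℤ)

end LatticeSum

end

/-!
Triples of sum zero are parametrised by the pairs `(p, q)` of coordinate vectors of their first two
members, and the summand is `y³ / (a b c)` with `a = ‖u‖²`, `b = ‖v‖²`, `c = ‖u + v‖²`. The
determinant of `(p, q)` vanishes exactly for the collinear triples. Absolute convergence follows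
from `(a b c)⁻¹ ≤ ∑ (‖u‖ ‖v‖)⁻³`, summed over the three pairs of vectors, and `∑ ‖u‖⁻³ < ∞`.

*Non-collinear triples.* Let `θ(u, v)` be the angle between `u` and `v`, let `A` be the area of
their parallelogram, and put `H = θ - sin θ cos θ`. Additivity of angles and Heron's formula give
the telescoping identity `2 A³ / (a b c) = H(u, v) - H(u, u + v) - H(u + v, v)`
(`argDefect_sub_sub`). Over all oriented bases of a lattice, `H` is not summable, as `θ` may be
near `π`. So `π` is subtracted from `H` whenever `(p, q)` is obtuse for the integral
hexagonal form `hexForm`, which never vanishes on a basis. The outcome `regDefect` is of order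
`‖u‖⁻³ ‖v‖⁻³`, and it is odd under `(u, v) ↦ (-v, u)`, so its sum over `SL(2, ℤ)` is zero. Summing
the identity over `SL(2, ℤ)`, all these terms disappear, and what remains is `π` times the number
of bases that belong to an obtuse superbase of the hexagonal form. By Selling's argument there are
six of them (`mem_obtuseBases_iff`). Hence the oriented bases contribute `3 π / A³`
(`hasSum_inv_normSq_bases`). An arbitrary pair of positive determinant is, uniquely, the product of
an element of `SL(2, ℤ)` with a Hermite normal form `!![a, b; 0, d]`, so those pairs
contribute `3 π y⁻³ ∑ d / (a d)³ = 3 π ζ(2) ζ(3) / y³ = π³ ζ(3) / (2 y³)`. The opposite orientation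
doubles this.

*Collinear triples.* For `u + v + w = 0` on one line, the numbers
`F(u, v) = ⟪u, v⟫ / (‖u‖² ‖v‖²)`, `F(v, w)`, `F(w, u)` have sum `0` and product `1 / (a b c)`. Hence
`1 / (a b c)` is a third of the sum of their cubes. The sum of `F(u, v)³` over all collinear pairs
vanishes by `v ↦ -v`, so that over the pairs with `u + v ≠ 0` it is `∑ ‖u‖⁻⁶`, which is
`2 E(z, 3) / y³`.
-/

open Complex ComplexConjugate Matrix.SpecialLinearGroup
open scoped MatrixGroups

namespace LatticeSum

/-! ### The telescoping identity for angles -/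

/-- For `w` of argument `θ`, the quantity `θ - sin θ cos θ`. -/
noncomputable def argDefect (w : ℂ) : ℝ := arg w - w.re * w.im / normSq w

lemma arg_mem_Ioo_of_im_pos {w : ℂ} (hw : 0 < w.im) : arg w ∈ Set.Ioo 0 Real.pi := by
  have h0 : 0 ≤ arg w := arg_nonneg_iff.2 hw.le
  have h1 : arg w < Real.pi := arg_lt_pi_iff.2 (Or.inr hw.ne')
  refine ⟨lt_of_le_of_ne h0 fun h => ?_, h1⟩
  have := (arg_eq_zero_iff.1 h.symm).2
  exact hw.ne' this

lemma add_add_two_mul_re_pos {w : ℂ} {a b : ℝ} (ha : 0 < a) (hb : 0 < b) (hw : 0 < w.im)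
    (hab : a * b = normSq w) : 0 < a + b + 2 * w.re := by
  rw [normSq_apply] at hab
  by_contra! h
  nlinarith [sq_nonneg (a - b), mul_pos hw hw]

lemma arg_add_arg_of_mul_eq_normSq {w : ℂ} {a b : ℝ} (ha : 0 < a) (hb : 0 < b) (hw : 0 < w.im)
    (hab : a * b = normSq w) : arg (w + a) + arg (w + b) = arg w := by
  have hc := add_add_two_mul_re_pos ha hb hw hab
  have hprod : (w + a) * (w + b) = w * ((a + b + 2 * w.re : ℝ) : ℂ) := by
    rw [normSq_apply] at hab
    apply Complex.ext <;> simp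
    · nlinarith
    · ring
  have h1 : 0 < (w + a).im := by simpa using hw
  have h2 : 0 < (w + b).im := by simpa using hw
  have ne {x : ℂ} (hx : 0 < x.im) : x ≠ 0 := by rintro rfl; simp at hx
  have key := arg_mul_coe_angle (ne h1) (ne h2)
  rw [hprod, arg_mul_real hc, ← Real.Angle.coe_add, Real.Angle.angle_eq_iff_two_pi_dvd_sub] at key
  obtain ⟨k, hk⟩ := key
  have i1 := arg_mem_Ioo_of_im_pos h1
  have i2 := arg_mem_Ioo_of_im_pos h2
  have i3 := arg_mem_Ioo_of_im_pos hw
  simp only [Set.mem_Ioo] at i1 i2 i3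
  have hpi := Real.pi_pos
  -- both sides lie in `(0, 2π)` and the left one in `(0, π)`, so the multiple of `2π` is zero
  have k1 : (k : ℝ) < 1 := by nlinarith
  have k2 : (-1 : ℝ) < k := by nlinarith
  have : k = 0 := by
    have : k < 1 := by exact_mod_cast k1
    have : -1 < k := by exact_mod_cast k2
    omega
  subst this
  simp at hk
  linarith

/-- The telescoping identity. If `w = u * conj v`, then `a = ‖u‖²`, `b = ‖v‖²` turn the three
arguments of `argDefect` into `u * conj v`, `u * conj (u + v)` and `(u + v) * conj v`. -/
lemma argDefect_sub_sub {w : ℂ} {a b : ℝ} (ha : 0 < a) (hb : 0 < b) (hw : 0 < w.im)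
    (hab : a * b = normSq w) :
    argDefect w - argDefect (w + a) - argDefect (w + b) =
      2 * w.im ^ 3 / (a * b * (a + b + 2 * w.re)) := by
  have hc := add_add_two_mul_re_pos ha hb hw hab
  have harg := arg_add_arg_of_mul_eq_normSq ha hb hw hab
  have n1 : normSq (w + a) = a * (a + b + 2 * w.re) := by
    rw [normSq_apply] at *; simp; nlinarith
  have n2 : normSq (w + b) = b * (a + b + 2 * w.re) := by
    rw [normSq_apply] at *; simp; nlinarith
  have hre : w.im ^ 2 = a * b - w.re ^ 2 := by rw [hab, normSq_apply]; ring
  have him : w.im ^ 3 = w.im * (a * b - w.re ^ 2) := by rw [← hre]; ring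
  unfold argDefect
  rw [n1, n2, ← hab, him, ← harg]
  obtain ⟨c, hc'⟩ : ∃ c, c = a + b + 2 * w.re := ⟨_, rfl⟩
  rw [← hc'] at hc ⊢
  simp only [add_re, add_im, ofReal_re, ofReal_im, add_zero]
  field_simp
  rw [hc']
  ring

lemma argDefect_neg_conj {w : ℂ} (hw : 0 < w.im) :
    argDefect (-conj w) = Real.pi - argDefect w := by
  have h : arg (-conj w) = Real.pi - arg w := by
    have hc : arg (conj w) = -arg w := by
      rw [arg_conj, if_neg (arg_mem_Ioo_of_im_pos hw).2.ne]
    rw [arg_neg_eq_arg_add_pi_of_im_neg (by simpa using hw), hc]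
    ring
  unfold argDefect
  rw [h]
  simp only [neg_re, conj_re, neg_im, conj_im, normSq_neg, normSq_conj]
  ring

lemma argDefect_eq_sub_sin_mul_cos {w : ℂ} (hw : w ≠ 0) :
    argDefect w = arg w - Real.sin (arg w) * Real.cos (arg w) := by
  rw [argDefect, sin_arg, cos_arg hw, normSq_eq_norm_sq]
  have : ‖w‖ ≠ 0 := norm_ne_zero_iff.2 hw
  field_simp

lemma sub_sin_mul_cos_nonneg {x : ℝ} (hx : 0 ≤ x) : 0 ≤ x - Real.sin x * Real.cos x := by
  have h := Real.sin_le (x := 2 * x) (by linarith)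
  rw [Real.sin_two_mul] at h
  linarith

lemma sub_sin_mul_cos_le {x : ℝ} (hx : 0 < x) (hx' : x ≤ Real.pi / 2) :
    x - Real.sin x * Real.cos x ≤ 4 * Real.sin x ^ 3 := by
  have h := Real.sin_gt_sub_cube (x := 2 * x) (by linarith)
  rw [Real.sin_two_mul] at h
  have hs := Real.mul_le_sin hx.le hx'
  have hpi := Real.pi_pos
  have h4 := Real.pi_lt_d2
  have hx2 : x ≤ 1.6 * Real.sin x := by
    have : x = Real.pi / 2 * (2 / Real.pi * x) := by field_simp
    have h0 : 0 ≤ 2 / Real.pi * x := by positivity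
    nlinarith
  have h3 : x ^ 3 ≤ (1.6 * Real.sin x) ^ 3 := by gcongr
  have hsp : 0 < Real.sin x := Real.sin_pos_of_pos_of_lt_pi hx (by linarith)
  have := pow_pos hsp 3
  nlinarith

/-- `argDefect w` is of order `(im w / ‖w‖)³` on a region where `arg w` stays away from `π`. -/
lemma abs_argDefect_le {w : ℂ} {β : ℝ} (hβ : 0 ≤ β) (hw : 0 < w.im) (hre : -β ≤ w.re) :
    |argDefect w| ≤ 4 * (β + w.im) ^ 3 / ‖w‖ ^ 3 := by
  have hw0 : w ≠ 0 := by rintro rfl; simp at hw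
  have hn : 0 < ‖w‖ := norm_pos_iff.2 hw0
  have hmem := arg_mem_Ioo_of_im_pos hw
  rw [argDefect_eq_sub_sin_mul_cos hw0, abs_of_nonneg (sub_sin_mul_cos_nonneg hmem.1.le)]
  rcases le_total 0 w.re with h | h
  · have h2 : arg w ≤ Real.pi / 2 := (le_abs_self _).trans (abs_arg_le_pi_div_two_iff.2 h)
    refine (sub_sin_mul_cos_le hmem.1 h2).trans ?_
    rw [sin_arg, div_pow, mul_div_assoc]
    gcongr
    linarith
  · have h1 : ‖w‖ ≤ β + w.im := by
      refine (norm_le_abs_re_add_abs_im w).trans ?_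
      rw [abs_of_nonpos h, abs_of_pos hw]
      linarith
    have h2 : (1 : ℝ) ≤ (β + w.im) ^ 3 / ‖w‖ ^ 3 := by
      rw [one_le_div (by positivity)]
      gcongr
    have h3 : -(Real.sin (arg w) * Real.cos (arg w)) ≤ 1 / 2 := by
      have := Real.neg_one_le_sin (2 * arg w)
      rw [Real.sin_two_mul] at this
      linarith
    have := Real.pi_lt_d2
    have := hmem.2
    rw [mul_div_assoc]
    linarith

/-! ### Obtuse superbases of the hexagonal form -/

/-- The hexagonal bilinear form on `ℤ²`, with Gram matrix `!![2, 1; 1, 2]`. -/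
def hexForm (p q : ℤ × ℤ) : ℤ := 2 * p.1 * q.1 + p.1 * q.2 + p.2 * q.1 + 2 * p.2 * q.2

/-- The determinant of two vectors of `ℤ²`. -/
def pairDet (p q : ℤ × ℤ) : ℤ := p.1 * q.2 - p.2 * q.1

/-- The form is odd on bases of `ℤ²`, so no basis is orthogonal. -/
lemma hexForm_ne_zero {p q : ℤ × ℤ} (h : pairDet p q = 1) : hexForm p q ≠ 0 := by
  unfold hexForm pairDet at *
  have : p.1 * q.2 = p.2 * q.1 + 1 := by linarith
  rw [this, mul_assoc, mul_assoc]
  omega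

lemma nonneg_of_hexForm_pos {p q : ℤ × ℤ} (h : pairDet p q = 1) (hB : 0 < hexForm p q) :
    0 ≤ p.1 * q.1 ∧ 0 ≤ p.2 * q.2 := by
  unfold hexForm pairDet at *
  obtain ⟨X, hX⟩ : ∃ X, X = p.1 * q.1 := ⟨_, rfl⟩
  obtain ⟨Y, hY⟩ : ∃ Y, Y = p.2 * q.2 := ⟨_, rfl⟩
  obtain ⟨W, hW⟩ : ∃ W, W = p.2 * q.1 := ⟨_, rfl⟩
  have hZ : p.1 * q.2 = W + 1 := by linarith
  have hXY : X * Y = (W + 1) * W := by rw [hX, hY, ← hZ, hW]; ring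
  have hB' : 0 < 2 * (X + Y) + (2 * W + 1) := by
    rw [hZ, mul_assoc, mul_assoc, ← hX, ← hY, ← hW] at hB; linarith
  have hpos : 0 ≤ X * Y := by
    rw [hXY]
    rcases le_or_gt 0 W with h | h
    · positivity
    · nlinarith
  rw [← hX, ← hY]
  -- `(2 W + 1)² = 1 + 4 X Y ≤ 1 + (X + Y)²`, so the sign of the form is that of `X + Y`
  have hsum : 0 ≤ X + Y := by
    by_contra! hs
    nlinarith [sq_nonneg (X - Y)]
  constructor
  · by_contra! hn
    nlinarith
  · by_contra! hn
    nlinarith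

/-- Selling's argument: an obtuse superbase `(p, q, -p - q)` of the hexagonal form has the
negated products `r, s, t ≥ 1` of its pairs of vectors subject to `rs + st + tr = 3`, so all of
them are `1`. -/
lemma hexForm_eq_of_obtuse {p q : ℤ × ℤ} (h : pairDet p q = 1) (h0 : hexForm p q < 0)
    (h1 : 0 < hexForm p (p + q)) (h2 : 0 < hexForm (p + q) q) :
    hexForm p p = 2 ∧ hexForm q q = 2 ∧ hexForm p q = -1 := by
  have e1 : hexForm p (p + q) = hexForm p p + hexForm p q := by simp [hexForm]; ring
  have e2 : hexForm (p + q) q = hexForm p q + hexForm q q := by simp [hexForm]; ring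
  have e3 : hexForm p p * hexForm q q - hexForm p q ^ 2 = 3 * pairDet p q ^ 2 := by
    simp [hexForm, pairDet]; ring
  rw [h] at e3
  rw [e1] at h1
  rw [e2] at h2
  generalize hexForm p p = a at *
  generalize hexForm q q = b at *
  generalize hexForm p q = c at *
  have r1 : 1 ≤ a + c := h1
  have r2 : 1 ≤ c + b := h2
  have r3 : 1 ≤ -c := by omega
  have k := mul_nonneg (sub_nonneg.2 r1) (sub_nonneg.2 r2)
  have k2 := mul_nonneg (sub_nonneg.2 r1) (sub_nonneg.2 r3)
  have k3 := mul_nonneg (sub_nonneg.2 r2) (sub_nonneg.2 r3)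
  have : c = -1 := by nlinarith
  subst this
  have : a = 2 := by nlinarith
  subst this
  refine ⟨rfl, by linarith, rfl⟩

/-- The oriented bases of `ℤ²` which, completed to superbases, are obtuse for the hexagonal
form. -/
def obtuseBases : Finset SL(2, ℤ) :=
  {⟨!![1, 0; -1, 1], by decide⟩, ⟨!![-1, 1; 0, -1], by decide⟩, ⟨!![0, -1; 1, 0], by decide⟩,
   ⟨!![-1, 0; 1, -1], by decide⟩, ⟨!![1, -1; 0, 1], by decide⟩, ⟨!![0, 1; -1, 0], by decide⟩}

lemma card_obtuseBases : obtuseBases.card = 6 := by decide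

/-- The rows of a matrix of `SL(2, ℤ)`, an oriented basis of `ℤ²`. -/
def rows (g : SL(2, ℤ)) : (ℤ × ℤ) × (ℤ × ℤ) := ((g 0 0, g 0 1), (g 1 0, g 1 1))

lemma pairDet_rows (g : SL(2, ℤ)) : pairDet (rows g).1 (rows g).2 = 1 := by
  have := g.det_coe
  rw [Matrix.det_fin_two] at this
  simpa [pairDet, rows] using this

lemma rows_injective : Function.Injective rows := by
  intro g h e
  simp only [rows, Prod.mk.injEq] at e
  ext i j
  fin_cases i <;> fin_cases j <;> simp [e]

lemma mem_obtuseBases_iff (g : SL(2, ℤ)) : g ∈ obtuseBases ↔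
    hexForm (rows g).1 (rows g).2 < 0 ∧ 0 < hexForm (rows g).1 ((rows g).1 + (rows g).2) ∧
      0 < hexForm ((rows g).1 + (rows g).2) (rows g).2 := by
  constructor
  · intro h
    have : ∀ g ∈ obtuseBases, hexForm (rows g).1 (rows g).2 < 0 ∧
        0 < hexForm (rows g).1 ((rows g).1 + (rows g).2) ∧
        0 < hexForm ((rows g).1 + (rows g).2) (rows g).2 := by decide
    exact this g h
  · rintro ⟨h0, h1, h2⟩
    have hd := pairDet_rows g
    obtain ⟨ha, hb, hc⟩ := hexForm_eq_of_obtuse hd h0 h1 h2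
    have bound {x y : ℤ} (h : hexForm (x, y) (x, y) = 2) : (-1 ≤ x ∧ x ≤ 1) ∧ -1 ≤ y ∧ y ≤ 1 := by
      simp only [hexForm] at h
      refine ⟨⟨?_, ?_⟩, ?_, ?_⟩ <;> by_contra! hn <;>
        nlinarith [sq_nonneg (x + 2 * y), sq_nonneg (y + 2 * x)]
    have b1 := bound ha
    have b2 := bound hb
    have hmem : g ∈ obtuseBases ↔ rows g ∈ obtuseBases.image rows := by
      simp [rows_injective.eq_iff]
    rw [hmem]
    simp only [rows] at *
    generalize g 0 0 = x at *
    generalize g 0 1 = y at *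
    generalize g 1 0 = x' at *
    generalize g 1 1 = y' at *
    have : ∀ x ∈ Finset.Icc (-1 : ℤ) 1, ∀ y ∈ Finset.Icc (-1 : ℤ) 1, ∀ x' ∈ Finset.Icc (-1 : ℤ) 1,
        ∀ y' ∈ Finset.Icc (-1 : ℤ) 1, pairDet (x, y) (x', y') = 1 →
          hexForm (x, y) (x', y') = -1 → hexForm (x, y) (x, y) = 2 →
          hexForm (x', y') (x', y') = 2 → ((x, y), (x', y')) ∈ obtuseBases.image rows := by
      decide
    exact this x (by simpa using b1.1) y (by simpa using b1.2) x' (by simpa using b2.1) y'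
      (by simpa using b2.2) hd hc ha hb

/-- Passing from the superbase `(p, q, -p - q)` to its two successors `(p, p + q)` and
`(p + q, q)` preserves the number of obtuse pairs, except at the obtuse superbases. -/
lemma obtuse_sub_sub (g : SL(2, ℤ)) (x : ℝ) :
    (if hexForm (rows g).1 (rows g).2 < 0 then x else 0) -
      (if hexForm (rows g).1 ((rows g).1 + (rows g).2) < 0 then x else 0) -
      (if hexForm ((rows g).1 + (rows g).2) (rows g).2 < 0 then x else 0) =
    if g ∈ obtuseBases then x else 0 := by
  have hd := pairDet_rows g
  simp only [mem_obtuseBases_iff]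
  have n0 := hexForm_ne_zero hd
  have n1 : hexForm (rows g).1 ((rows g).1 + (rows g).2) ≠ 0 :=
    hexForm_ne_zero (by rw [← hd]; simp [pairDet]; ring)
  have n2 : hexForm ((rows g).1 + (rows g).2) (rows g).2 ≠ 0 :=
    hexForm_ne_zero (by rw [← hd]; simp [pairDet]; ring)
  generalize (rows g).1 = p at *
  generalize (rows g).2 = q at *
  have e1 : hexForm p (p + q) = hexForm p p + hexForm p q := by simp [hexForm]; ring
  have e2 : hexForm (p + q) q = hexForm p q + hexForm q q := by simp [hexForm]; ring
  have pos (p : ℤ × ℤ) : 0 ≤ hexForm p p := by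
    simp only [hexForm]
    nlinarith [sq_nonneg (p.1 + p.2), sq_nonneg p.1, sq_nonneg p.2]
  have ha := pos p
  have hb := pos q
  have hab := pos (p + q)
  have e3 : hexForm (p + q) (p + q) = hexForm p (p + q) + hexForm (p + q) q := by
    simp [hexForm]; ring
  split_ifs <;> first | omega | simp

/-! ### The sum over the bases of a lattice -/

/-- The vector with coordinates `p` in the frame `(U, V)`. -/
def vec (U V : ℂ) (p : ℤ × ℤ) : ℂ := p.1 * U + p.2 * V

lemma vec_add (U V : ℂ) (p q : ℤ × ℤ) : vec U V (p + q) = vec U V p + vec U V q := by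
  simp [vec]; ring

lemma vec_neg (U V : ℂ) (p : ℤ × ℤ) : vec U V (-p) = -vec U V p := by
  simp [vec]; ring

@[simp] lemma vec_zero (U V : ℂ) : vec U V 0 = 0 := by simp [vec]

lemma im_vec_mul_conj_vec (U V : ℂ) (p q : ℤ × ℤ) :
    (vec U V p * conj (vec U V q)).im = pairDet p q * (U * conj V).im := by
  simp [vec, pairDet]; ring

lemma re_vec_mul_conj_vec (U V : ℂ) (p q : ℤ × ℤ) :
    (vec U V p * conj (vec U V q)).re =
      p.1 * q.1 * normSq U + p.2 * q.2 * normSq V +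
        (p.1 * q.2 + p.2 * q.1) * (U * conj V).re := by
  simp [vec, normSq_apply]; ring

lemma vec_ne_zero {U V : ℂ} (h : 0 < (U * conj V).im) {p : ℤ × ℤ} (hp : p ≠ 0) :
    vec U V p ≠ 0 := by
  intro h0
  have h1 := im_vec_mul_conj_vec U V p (0, 1)
  have h2 := im_vec_mul_conj_vec U V p (1, 0)
  rw [h0, zero_mul, zero_im, eq_comm, mul_eq_zero, or_iff_left h.ne'] at h1 h2
  simp [pairDet] at h1 h2
  exact hp (Prod.ext h1 h2)

lemma summable_inv_norm_vec_pow_three {U V : ℂ} (h : 0 < (U * conj V).im) :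
    Summable fun p : ℤ × ℤ => (‖vec U V p‖ ^ 3)⁻¹ := by
  have hV : V ≠ 0 := by rintro rfl; simp at h
  have hVn : 0 < normSq V := normSq_pos.2 hV
  have him : 0 < (U / V).im := by
    rw [div_eq_mul_inv, inv_def, ← mul_assoc, im_mul_ofReal]
    positivity
  let τ : UpperHalfPlane := ⟨U / V, him⟩
  have hs := EisensteinSeries.summable_one_div_norm_rpow (k := 3) (by norm_num)
  rw [← (finTwoArrowEquiv ℤ).symm.summable_iff] at hs
  have hs' := (hs.mul_left (EisensteinSeries.r τ ^ (-3 : ℝ))).mul_left ((‖V‖ ^ 3)⁻¹)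
  refine hs'.of_nonneg_of_le (fun p => by positivity) fun p => ?_
  have hb := EisensteinSeries.summand_bound τ (k := 3) (by norm_num)
    ((finTwoArrowEquiv ℤ).symm p)
  have hvec : vec U V p = V * ((p.1 : ℂ) * (τ : ℂ) + p.2) := by
    change p.1 * U + p.2 * V = V * ((p.1 : ℂ) * (U / V) + p.2)
    field_simp
  rw [hvec, norm_mul, mul_pow, mul_inv]
  refine mul_le_mul_of_nonneg_left ?_ (by positivity)
  refine le_trans (le_of_eq ?_) hb
  rw [Real.rpow_neg (norm_nonneg _)]
  norm_cast

lemma summable_inv_norm_vec_mul {U V : ℂ} (h : 0 < (U * conj V).im) :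
    Summable fun x : (ℤ × ℤ) × (ℤ × ℤ) => (‖vec U V x.1‖ ^ 3)⁻¹ * (‖vec U V x.2‖ ^ 3)⁻¹ :=
  (summable_inv_norm_vec_pow_three h).mul_of_nonneg (summable_inv_norm_vec_pow_three h)
    (fun _ => by positivity) (fun _ => by positivity)

/-- `X s² + Y t²` beats the cross term `s t (Z + W)` up to `s t` as soon as `X Y = Z W` with
`Z = W + 1` and `1 ≤ |Z + W|`, as `(Z + W)² = 1 + 4 X Y`. -/
lemma neg_mul_le_of_mul_eq {X Y W s t r : ℝ} (hX : 0 ≤ X) (hY : 0 ≤ Y) (hs : 0 ≤ s) (ht : 0 ≤ t)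
    (hXY : X * Y = (W + 1) * W) (hW : 1 ≤ |2 * W + 1|) (hr : |r| ≤ s * t) :
    -(s * t) ≤ X * s ^ 2 + Y * t ^ 2 + (2 * W + 1) * r := by
  obtain ⟨k, hk⟩ : ∃ k, k = |2 * W + 1| := ⟨_, rfl⟩
  have hk2 : k ^ 2 = 1 + 4 * (X * Y) := by rw [hk, sq_abs, hXY]; ring
  rw [← hk] at hW
  have hst : 0 ≤ s * t := mul_nonneg hs ht
  have h1 : s * t * (k - 1) ≤ X * s ^ 2 + Y * t ^ 2 := by
    refine le_of_sq_le_sq ?_ (by positivity)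
    have : (X * s ^ 2 + Y * t ^ 2) ^ 2 =
        (X * s ^ 2 - Y * t ^ 2) ^ 2 + (k ^ 2 - 1) * (s * t) ^ 2 := by rw [hk2]; ring
    rw [this]
    nlinarith [sq_nonneg (X * s ^ 2 - Y * t ^ 2), mul_nonneg (sub_nonneg.2 hW) (sq_nonneg (s * t))]
  have h2 : |(2 * W + 1) * r| ≤ k * (s * t) := by
    rw [abs_mul, ← hk]
    gcongr
  have := (abs_le.1 h2).1
  linarith

lemma neg_norm_mul_norm_le_re {U V : ℂ} {p q : ℤ × ℤ} (hd : pairDet p q = 1)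
    (hB : 0 < hexForm p q) :
    -(‖U‖ * ‖V‖) ≤ (vec U V p * conj (vec U V q)).re := by
  obtain ⟨hX, hY⟩ := nonneg_of_hexForm_pos hd hB
  have hZ : p.1 * q.2 = p.2 * q.1 + 1 := by unfold pairDet at hd; linarith
  have hW : 1 ≤ |2 * (p.2 * q.1) + 1| := Int.one_le_abs (by omega)
  have hXY : (p.1 * q.1) * (p.2 * q.2) = (p.2 * q.1 + 1) * (p.2 * q.1) := by rw [← hZ]; ring
  have hr : |(U * conj V).re| ≤ ‖U‖ * ‖V‖ := by
    simpa using abs_re_le_norm (U * conj V)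
  have key := neg_mul_le_of_mul_eq (X := ((p.1 * q.1 : ℤ) : ℝ)) (Y := ((p.2 * q.2 : ℤ) : ℝ))
    (W := ((p.2 * q.1 : ℤ) : ℝ)) (by exact_mod_cast hX) (by exact_mod_cast hY) (norm_nonneg U)
    (norm_nonneg V) (by exact_mod_cast hXY) (by exact_mod_cast hW) hr
  rw [re_vec_mul_conj_vec, normSq_eq_norm_sq, normSq_eq_norm_sq]
  have hZ' : (p.1 * q.2 : ℝ) = p.2 * q.1 + 1 := by exact_mod_cast hZ
  rw [hZ']
  push_cast at key
  linarith

/-- The defect of the angle between two vectors, taken with respect to the straight angle if the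
pair is obtuse for the hexagonal form. -/
noncomputable def regDefect (U V : ℂ) (x : (ℤ × ℤ) × (ℤ × ℤ)) : ℝ :=
  argDefect (vec U V x.1 * conj (vec U V x.2)) -
    if hexForm x.1 x.2 < 0 then Real.pi else 0

lemma hexForm_neg_right_swap (p q : ℤ × ℤ) : hexForm (-q) p = -hexForm p q := by
  simp [hexForm]; ring

lemma pairDet_neg_right_swap (p q : ℤ × ℤ) : pairDet (-q) p = pairDet p q := by
  simp [pairDet]; ring

lemma regDefect_neg_swap {U V : ℂ} (h : 0 < (U * conj V).im) {p q : ℤ × ℤ}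
    (hd : pairDet p q = 1) : regDefect U V (-q, p) = -regDefect U V (p, q) := by
  have hw : 0 < (vec U V p * conj (vec U V q)).im := by
    rw [im_vec_mul_conj_vec, hd]; simpa using h
  have e : vec U V (-q) * conj (vec U V p) = -conj (vec U V p * conj (vec U V q)) := by
    rw [vec_neg]; simp; ring
  simp only [regDefect, e, argDefect_neg_conj hw, hexForm_neg_right_swap]
  have := hexForm_ne_zero hd
  split_ifs <;> first | omega | ring

lemma abs_regDefect_le {U V : ℂ} (h : 0 < (U * conj V).im) {p q : ℤ × ℤ}
    (hd : pairDet p q = 1) :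
    |regDefect U V (p, q)| ≤ 4 * (‖U‖ * ‖V‖ + (U * conj V).im) ^ 3 *
      ((‖vec U V p‖ ^ 3)⁻¹ * (‖vec U V q‖ ^ 3)⁻¹) := by
  wlog hB : 0 < hexForm p q generalizing p q
  · have hne := hexForm_ne_zero hd
    have := this (p := -q) (q := p) (by rw [pairDet_neg_right_swap, hd])
      (by rw [hexForm_neg_right_swap]; omega)
    rw [regDefect_neg_swap h hd, abs_neg, vec_neg, norm_neg] at this
    rwa [mul_comm (‖vec U V p‖ ^ 3)⁻¹]
  have him : (vec U V p * conj (vec U V q)).im = (U * conj V).im := by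
    rw [im_vec_mul_conj_vec, hd]; simp
  have key := abs_argDefect_le (w := vec U V p * conj (vec U V q)) (by positivity)
    (by rw [him]; exact h) (neg_norm_mul_norm_le_re (U := U) (V := V) hd hB)
  rw [him, norm_mul, norm_conj, mul_pow, div_eq_mul_inv, mul_inv] at key
  simpa [regDefect, not_lt.2 hB.le] using key

lemma summable_regDefect {U V : ℂ} (h : 0 < (U * conj V).im) :
    Summable fun g : SL(2, ℤ) => regDefect U V (rows g) := by
  refine Summable.of_norm_bounded
    (((summable_inv_norm_vec_mul h).comp_injective rows_injective).mul_left
      (4 * (‖U‖ * ‖V‖ + (U * conj V).im) ^ 3)) fun g => ?_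
  exact abs_regDefect_le h (pairDet_rows g)

lemma rows_S_mul (g : SL(2, ℤ)) : rows (ModularGroup.S * g) = (-(rows g).2, (rows g).1) := by
  simp [rows, ModularGroup.coe_S, Matrix.mul_apply, Fin.sum_univ_two]

lemma rows_T_mul (g : SL(2, ℤ)) :
    rows (ModularGroup.T * g) = ((rows g).1 + (rows g).2, (rows g).2) := by
  simp [rows, ModularGroup.coe_T, Matrix.mul_apply, Fin.sum_univ_two]

lemma rows_transpose_T_mul (g : SL(2, ℤ)) :
    rows (ModularGroup.T.transpose * g) = ((rows g).1, (rows g).1 + (rows g).2) := by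
  simp [rows, ModularGroup.coe_T, Matrix.mul_apply, Fin.sum_univ_two]

/-- Left multiplication by `S` changes the sign of `regDefect`. -/
lemma tsum_regDefect {U V : ℂ} (h : 0 < (U * conj V).im) :
    ∑' g : SL(2, ℤ), regDefect U V (rows g) = 0 := by
  have e := (Equiv.mulLeft ModularGroup.S).tsum_eq fun g : SL(2, ℤ) => regDefect U V (rows g)
  simp only [Equiv.coe_mulLeft, rows_S_mul] at e
  rw [tsum_congr fun g => regDefect_neg_swap h (pairDet_rows g), tsum_neg] at e
  simp only [Prod.mk.eta] at e
  linarith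

lemma regDefect_sub_sub {U V : ℂ} (h : 0 < (U * conj V).im) (g : SL(2, ℤ)) :
    regDefect U V (rows g) - regDefect U V (rows (ModularGroup.T.transpose * g)) -
        regDefect U V (rows (ModularGroup.T * g)) =
      2 * (U * conj V).im ^ 3 * (normSq (vec U V (rows g).1) * normSq (vec U V (rows g).2) *
        normSq (vec U V ((rows g).1 + (rows g).2)))⁻¹ -
      if g ∈ obtuseBases then Real.pi else 0 := by
  rw [rows_transpose_T_mul, rows_T_mul, ← obtuse_sub_sub]
  have hd := pairDet_rows g
  rw [← Prod.mk.eta (p := rows g)]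
  generalize (rows g).1 = p at *
  generalize (rows g).2 = q at *
  have ne {r : ℤ × ℤ} (hr : r ≠ 0) : 0 < normSq (vec U V r) := normSq_pos.2 (vec_ne_zero h hr)
  have hp : p ≠ 0 := by rintro rfl; simp [pairDet] at hd
  have hq : q ≠ 0 := by rintro rfl; simp [pairDet] at hd
  have him : (vec U V p * conj (vec U V q)).im = (U * conj V).im := by
    rw [im_vec_mul_conj_vec, hd]; simp
  have key := argDefect_sub_sub (ne hp) (ne hq) (by rw [him]; exact h)
    (show _ = normSq (vec U V p * conj (vec U V q)) by rw [normSq_mul, normSq_conj])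
  rw [him] at key
  have e1 : vec U V p * conj (vec U V (p + q)) =
      vec U V p * conj (vec U V q) + (normSq (vec U V p) : ℝ) := by
    rw [vec_add, map_add, mul_add, mul_conj, add_comm]
  have e2 : vec U V (p + q) * conj (vec U V q) =
      vec U V p * conj (vec U V q) + (normSq (vec U V q) : ℝ) := by
    rw [vec_add, add_mul, mul_conj]
  have e3 : normSq (vec U V (p + q)) = normSq (vec U V p) + normSq (vec U V q) +
      2 * (vec U V p * conj (vec U V q)).re := by
    rw [vec_add, normSq_add]
  simp only [regDefect, e1, e2]
  rw [e3, ← div_eq_mul_inv, ← key]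
  ring

/-- The sum over the oriented bases of the lattice spanned by `U` and `V`. -/
theorem hasSum_inv_normSq_bases {U V : ℂ} (h : 0 < (U * conj V).im) :
    HasSum (fun g : SL(2, ℤ) => (normSq (vec U V (rows g).1) * normSq (vec U V (rows g).2) *
        normSq (vec U V ((rows g).1 + (rows g).2)))⁻¹) (3 * Real.pi / (U * conj V).im ^ 3) := by
  have hs : HasSum (fun g : SL(2, ℤ) => regDefect U V (rows g)) 0 := by
    simpa [tsum_regDefect h] using (summable_regDefect h).hasSum
  have hL := (Equiv.mulLeft ModularGroup.T.transpose).hasSum_iff.2 hs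
  have hT := (Equiv.mulLeft ModularGroup.T).hasSum_iff.2 hs
  have hO : HasSum (fun g : SL(2, ℤ) => if g ∈ obtuseBases then Real.pi else 0)
      (6 * Real.pi) := by
    have : HasSum (fun g : SL(2, ℤ) => if g ∈ obtuseBases then Real.pi else 0)
        (∑ g ∈ obtuseBases, if g ∈ obtuseBases then Real.pi else 0) :=
      hasSum_sum_of_ne_finset_zero fun g hg => if_neg hg
    rwa [Finset.sum_congr rfl fun g hg => if_pos hg, Finset.sum_const, card_obtuseBases,
      nsmul_eq_mul, Nat.cast_ofNat] at this
  have key := (((hs.sub hL).sub hT).add hO).mul_left (2 * (U * conj V).im ^ 3)⁻¹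
  have hA := (pow_pos h 3).ne'
  have hval : (2 * (U * conj V).im ^ 3)⁻¹ * (0 - 0 - 0 + 6 * Real.pi) =
      3 * Real.pi / (U * conj V).im ^ 3 := by
    field_simp
    ring
  rw [hval] at key
  refine key.congr_fun fun g => ?_
  simp only [Function.comp_apply, Equiv.coe_mulLeft]
  rw [regDefect_sub_sub h, sub_add_cancel, inv_mul_cancel_left₀ (by positivity)]

/-! ### Summability over all pairs -/

/-- The summand `1 / (‖ω₁‖² ‖ω₂‖² ‖ω₃‖²)` at the triple determined by the pair `x`; it vanishes,
by the convention `0⁻¹ = 0`, as soon as one of the three vectors does. -/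
noncomputable def invProd (U V : ℂ) (x : (ℤ × ℤ) × (ℤ × ℤ)) : ℝ :=
  (normSq (vec U V x.1) * normSq (vec U V x.2) * normSq (vec U V (x.1 + x.2)))⁻¹

lemma invProd_nonneg (U V : ℂ) (x : (ℤ × ℤ) × (ℤ × ℤ)) : 0 ≤ invProd U V x :=
  inv_nonneg.2 (mul_nonneg (mul_nonneg (normSq_nonneg _) (normSq_nonneg _)) (normSq_nonneg _))

lemma mul_mul_le_add_pow_three {x y z : ℝ} (hx : 0 ≤ x) (hy : 0 ≤ y) (hz : 0 ≤ z) :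
    x * y * z ≤ x ^ 3 + y ^ 3 + z ^ 3 := by
  have h : x ^ 3 + y ^ 3 + z ^ 3 - 3 * (x * y * z) =
      (x + y + z) * ((x - y) ^ 2 + (y - z) ^ 2 + (z - x) ^ 2) / 2 := by ring
  have : 0 ≤ (x + y + z) * ((x - y) ^ 2 + (y - z) ^ 2 + (z - x) ^ 2) / 2 := by positivity
  have : 0 ≤ x * y * z := by positivity
  linarith

lemma summable_invProd {U V : ℂ} (h : 0 < (U * conj V).im) : Summable (invProd U V) := by
  have hs := summable_inv_norm_vec_mul h
  have h1 := hs.comp_injective (i := fun x : (ℤ × ℤ) × (ℤ × ℤ) => (x.2, x.1 + x.2))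
    (by rintro ⟨a, b⟩ ⟨c, d⟩ e; simp only [Prod.mk.injEq] at e; obtain ⟨rfl, e⟩ := e; simpa using e)
  have h2 := hs.comp_injective (i := fun x : (ℤ × ℤ) × (ℤ × ℤ) => (x.1 + x.2, x.1))
    (by rintro ⟨a, b⟩ ⟨c, d⟩ e; simp only [Prod.mk.injEq] at e; obtain ⟨e, rfl⟩ := e; simpa using e)
  refine ((hs.add h1).add h2).of_nonneg_of_le (fun x => invProd_nonneg U V x) fun x => ?_
  simp only [invProd, normSq_eq_norm_sq, Function.comp_apply]
  have key := mul_mul_le_add_pow_three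
    (x := ‖vec U V x.1‖⁻¹ * ‖vec U V x.2‖⁻¹) (y := ‖vec U V x.2‖⁻¹ * ‖vec U V (x.1 + x.2)‖⁻¹)
    (z := ‖vec U V (x.1 + x.2)‖⁻¹ * ‖vec U V x.1‖⁻¹) (by positivity) (by positivity) (by positivity)
  simp only [mul_inv, ← inv_pow, ← mul_pow]
  refine le_trans (le_of_eq ?_) key
  ring

/-! ### Hermite normal forms -/

/-- The Hermite normal forms `!![a, b; 0, d]` with `0 < a` and `0 ≤ b < d`, given by their rows;
`x` encodes `(a - 1, d - 1, b)`. -/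
def hermite (x : Σ n : ℕ × ℕ, Fin (n.2 + 1)) : (ℤ × ℤ) × (ℤ × ℤ) :=
  (((x.1.1 : ℤ) + 1, ((x.2 : ℕ) : ℤ)), (0, (x.1.2 : ℤ) + 1))

/-- The rows of `g * h`, where `x` holds the rows of `h`. -/
def rowsMul (g : SL(2, ℤ)) (x : (ℤ × ℤ) × (ℤ × ℤ)) : (ℤ × ℤ) × (ℤ × ℤ) :=
  (g 0 0 • x.1 + g 0 1 • x.2, g 1 0 • x.1 + g 1 1 • x.2)

lemma pairDet_rowsMul (g : SL(2, ℤ)) (x : (ℤ × ℤ) × (ℤ × ℤ)) :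
    pairDet (rowsMul g x).1 (rowsMul g x).2 = pairDet x.1 x.2 := by
  have hd := pairDet_rows g
  calc _ = pairDet (rows g).1 (rows g).2 * pairDet x.1 x.2 := by
        simp [pairDet, rowsMul, rows]; ring
    _ = _ := by rw [hd, one_mul]

lemma vec_vec (U V : ℂ) (p q : ℤ × ℤ) (m n : ℤ) :
    vec (vec U V p) (vec U V q) (m, n) = vec U V (m • p + n • q) := by
  simp [vec]; ring

lemma invProd_rowsMul (U V : ℂ) (g : SL(2, ℤ)) (x : (ℤ × ℤ) × (ℤ × ℤ)) :
    invProd U V (rowsMul g x) = invProd (vec U V x.1) (vec U V x.2) (rows g) := by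
  simp only [invProd, vec_add]
  simp only [rows, rowsMul, vec_vec]

lemma rowsMul_hermite_injective :
    Function.Injective fun t : (Σ n : ℕ × ℕ, Fin (n.2 + 1)) × SL(2, ℤ) =>
      rowsMul t.2 (hermite t.1) := by
  rintro ⟨⟨⟨a, d⟩, b⟩, g⟩ ⟨⟨⟨a', d'⟩, b'⟩, g'⟩ e
  have hg := pairDet_rows g
  have hg' := pairDet_rows g'
  have hdet := pairDet_rowsMul g (hermite ⟨⟨a, d⟩, b⟩)
  have hdet' := pairDet_rowsMul g' (hermite ⟨⟨a', d'⟩, b'⟩)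
  simp only at e
  rw [e, hdet'] at hdet
  simp only [rowsMul, hermite, pairDet, rows, Prod.smul_mk, Prod.mk_add_mk, smul_eq_mul, mul_zero,
    add_zero, Prod.mk.injEq, sub_zero] at *
  obtain ⟨⟨e1, e2⟩, e3, e4⟩ := e
  -- the first column of the product is `a` times a primitive vector
  have ha1 : ((a : ℤ) + 1) ∣ (a' : ℤ) + 1 := by
    refine ⟨g 0 0 * g' 1 1 - g' 0 1 * g 1 0, ?_⟩
    linear_combination (-((a' : ℤ) + 1)) * hg' - g' 1 1 * e1 + g' 0 1 * e3
  have ha2 : ((a' : ℤ) + 1) ∣ (a : ℤ) + 1 := by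
    refine ⟨g' 0 0 * g 1 1 - g 0 1 * g' 1 0, ?_⟩
    linear_combination (-((a : ℤ) + 1)) * hg + g 1 1 * e1 - g 0 1 * e3
  have haa : a = a' := by
    have := Int.le_of_dvd (by omega) ha1
    have := Int.le_of_dvd (by omega) ha2
    omega
  subst haa
  have ha0 : (a : ℤ) + 1 ≠ 0 := by omega
  have hdd : d = d' := by
    have := mul_left_cancel₀ ha0 hdet
    omega
  subst hdd
  have c1 : g 0 0 = g' 0 0 := mul_right_cancel₀ ha0 e1
  have c2 : g 1 0 = g' 1 0 := mul_right_cancel₀ ha0 e3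
  rw [← c1] at e2 hg'
  rw [← c2] at e4 hg'
  have hb : ((d : ℤ) + 1) ∣ ((b : ℕ) : ℤ) - ((b' : ℕ) : ℤ) := by
    refine ⟨(g' 0 1 - g 0 1) * g 1 1 - g 0 1 * (g' 1 1 - g 1 1), ?_⟩
    linear_combination (-(((b : ℕ) : ℤ) - ((b' : ℕ) : ℤ))) * hg + g 1 1 * e2 - g 0 1 * e4
  have hbb : b = b' := by
    have h1 := b.2
    have h2 := b'.2
    have := Int.eq_zero_of_abs_lt_dvd hb (by rw [abs_lt]; simp only at h1 h2; omega)
    apply Fin.ext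
    omega
  subst hbb
  have hd0 : (d : ℤ) + 1 ≠ 0 := by omega
  have c3 : g 0 1 = g' 0 1 := mul_right_cancel₀ hd0 (by linarith)
  have c4 : g 1 1 = g' 1 1 := mul_right_cancel₀ hd0 (by linarith)
  have : g = g' := rows_injective (by simp [rows, c1, c2, c3, c4])
  exact ⟨rfl, this⟩

lemma exists_rowsMul_hermite_eq {x : (ℤ × ℤ) × (ℤ × ℤ)} (h : 0 < pairDet x.1 x.2) :
    ∃ t : (Σ n : ℕ × ℕ, Fin (n.2 + 1)) × SL(2, ℤ), rowsMul t.2 (hermite t.1) = x := by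
  obtain ⟨⟨p₁, p₂⟩, ⟨q₁, q₂⟩⟩ := x
  simp only [pairDet] at h
  have hg : 0 < Int.gcd p₁ q₁ := by
    rw [Nat.pos_iff_ne_zero, Ne, Int.gcd_eq_zero_iff]
    rintro ⟨rfl, rfl⟩
    simp at h
  obtain ⟨P, Q, hPQ, hP, hQ⟩ := Int.exists_gcd_one hg
  generalize hgg : Int.gcd p₁ q₁ = a at *
  subst hP hQ
  obtain ⟨r, s, hrs⟩ := Int.isCoprime_iff_gcd_eq_one.2 hPQ
  have ha : (0 : ℤ) < a := by exact_mod_cast hg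
  obtain ⟨d, hd⟩ : ∃ d, d = P * q₂ - p₂ * Q := ⟨_, rfl⟩
  have hd0 : 0 < d := by
    have : 0 < d * a := by rw [hd]; linarith
    exact pos_of_mul_pos_left this ha.le
  obtain ⟨t, ht⟩ : ∃ t, t = r * p₂ + s * q₂ := ⟨_, rfl⟩
  have hdiv := Int.emod_add_mul_ediv t d
  have hb0 := Int.emod_nonneg t hd0.ne'
  have hb1 := Int.emod_lt_of_pos t hd0
  obtain ⟨b, hb⟩ := Int.eq_ofNat_of_zero_le hb0
  obtain ⟨d', hd'⟩ := Int.eq_ofNat_of_zero_le (show 0 ≤ d - 1 by omega)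
  obtain ⟨a', ha'⟩ := Int.eq_ofNat_of_zero_le (show 0 ≤ (a : ℤ) - 1 by omega)
  refine ⟨⟨⟨⟨a', d'⟩, ⟨b, by simp only; omega⟩⟩,
    ⟨!![P, -s + P * (t / d); Q, r + Q * (t / d)], ?_⟩⟩, ?_⟩
  · rw [Matrix.det_fin_two_of]
    linear_combination hrs
  · have e1 : (a' : ℤ) + 1 = a := by omega
    have e2 : (d' : ℤ) + 1 = d := by omega
    rw [hb] at hdiv
    simp only [rowsMul, hermite, Matrix.of_apply, Matrix.cons_val', Matrix.cons_val_zero,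
      Matrix.cons_val_one, Matrix.cons_val_fin_one, Prod.smul_mk, Prod.mk_add_mk, smul_eq_mul,
      mul_zero, add_zero, e1, e2, Prod.mk.injEq, true_and]
    constructor
    · linear_combination P * hdiv + P * ht - s * hd + p₂ * hrs
    · linear_combination Q * hdiv + Q * ht + r * hd + q₂ * hrs

/-- Products of an oriented basis of `ℤ²` with a Hermite normal form enumerate the pairs of
positive determinant. -/
noncomputable def hermiteEquiv : (Σ n : ℕ × ℕ, Fin (n.2 + 1)) × SL(2, ℤ) ≃
    {x : (ℤ × ℤ) × (ℤ × ℤ) | 0 < pairDet x.1 x.2} :=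
  Equiv.ofBijective
    (fun t => ⟨rowsMul t.2 (hermite t.1), by
      rw [Set.mem_ofPred_eq, pairDet_rowsMul]
      simp only [pairDet, hermite, mul_zero, sub_zero]
      positivity⟩)
    ⟨fun _ _ e => rowsMul_hermite_injective (congrArg Subtype.val e), fun x =>
      let ⟨t, ht⟩ := exists_rowsMul_hermite_eq x.2
      ⟨t, Subtype.ext ht⟩⟩

/-! ### The sum over non-collinear pairs -/

lemma hasSum_inv_succ_pow {k : ℕ} (hk : 1 < k) :
    HasSum (fun n : ℕ => (((n : ℝ) + 1) ^ k)⁻¹) (riemannZeta k).re := by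
  have hs : Summable fun n : ℕ => (((n : ℝ) + 1) ^ k)⁻¹ := by
    have := (summable_nat_add_iff 1).2 (Real.summable_nat_pow_inv.2 hk)
    simpa using this
  have h := zeta_eq_tsum_one_div_nat_add_one_cpow (s := k) (by simpa using hk)
  have : riemannZeta k = ((∑' n : ℕ, (((n : ℝ) + 1) ^ k)⁻¹ : ℝ) : ℂ) := by
    rw [h, ofReal_tsum]
    simp
  rw [this, ofReal_re]
  exact hs.hasSum

/-- Sublattices of `ℤ U + ℤ V` are enumerated by Hermite normal forms, so that the sum over all
pairs is `∑ d / (a d)³ = ζ(3) ζ(2)` times the sum over bases. -/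
lemma hasSum_invProd_pairDet_pos {U V : ℂ} (h : 0 < (U * conj V).im) :
    HasSum (fun x : {x : (ℤ × ℤ) × (ℤ × ℤ) | 0 < pairDet x.1 x.2} => invProd U V x)
      (Real.pi ^ 3 * (riemannZeta 3).re / (2 * (U * conj V).im ^ 3)) := by
  have hsum := (summable_invProd h).subtype {x | 0 < pairDet x.1 x.2}
  obtain ⟨S, hS⟩ := hsum
  have e1 := hermiteEquiv.hasSum_iff.2 hS
  have e2 := e1.prod_fiberwise (g := fun t => 3 * Real.pi / ((t.1.1 + 1) * (t.1.2 + 1) *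
      (U * conj V).im) ^ 3) (fun t => by
    have him : (vec U V (hermite t).1 * conj (vec U V (hermite t).2)).im =
        (t.1.1 + 1) * (t.1.2 + 1) * (U * conj V).im := by
      rw [im_vec_mul_conj_vec]
      simp [pairDet, hermite]
    have hpos : 0 < (vec U V (hermite t).1 * conj (vec U V (hermite t).2)).im := by
      rw [him]; positivity
    have := hasSum_inv_normSq_bases hpos
    rw [him] at this
    refine this.congr_fun fun g => ?_
    exact invProd_rowsMul U V g (hermite t))
  have e3 := e2.sigma (fun n => hasSum_fintype _)
  have h3 := hasSum_inv_succ_pow (k := 3) (by norm_num)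
  have h2 := hasSum_inv_succ_pow (k := 2) (by norm_num)
  have e4 := (h3.mul h2 (h3.summable.mul_of_nonneg h2.summable (fun _ => by positivity)
    fun _ => by positivity)).mul_left (3 * Real.pi / (U * conj V).im ^ 3)
  have hz : (riemannZeta (2 : ℕ)).re = Real.pi ^ 2 / 6 := by
    have : riemannZeta (2 : ℕ) = ((Real.pi ^ 2 / 6 : ℝ) : ℂ) := by
      push_cast; exact riemannZeta_two
    rw [this, ofReal_re]
  have e5 : S = 3 * Real.pi / (U * conj V).im ^ 3 *
      ((riemannZeta (3 : ℕ)).re * (riemannZeta (2 : ℕ)).re) := by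
    refine e3.unique (e4.congr_fun fun n => ?_)
    simp only [Finset.sum_const, Finset.card_univ, Fintype.card_fin, nsmul_eq_mul]
    push_cast
    field_simp
  have : S = Real.pi ^ 3 * (riemannZeta 3).re / (2 * (U * conj V).im ^ 3) := by
    rw [e5, hz, Nat.cast_ofNat]
    field_simp
    ring
  rw [← this]
  exact hS

lemma invProd_swap (U V : ℂ) (x : (ℤ × ℤ) × (ℤ × ℤ)) :
    invProd U V x.swap = invProd U V x := by
  simp only [invProd, Prod.fst_swap, Prod.snd_swap, add_comm x.2, mul_comm (normSq (vec U V x.2))]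

/-- The sum over all pairs of nonzero determinant: the two orientations contribute equally. -/
lemma hasSum_invProd_pairDet_ne_zero {U V : ℂ} (h : 0 < (U * conj V).im) :
    HasSum (fun x : {x : (ℤ × ℤ) × (ℤ × ℤ) | pairDet x.1 x.2 ≠ 0} => invProd U V x)
      (Real.pi ^ 3 * (riemannZeta 3).re / (U * conj V).im ^ 3) := by
  have hpos := hasSum_invProd_pairDet_pos h
  have hdet (x : (ℤ × ℤ) × (ℤ × ℤ)) : pairDet x.2 x.1 = -pairDet x.1 x.2 := by
    simp [pairDet]; ring
  have hneg : HasSum (fun x : {x : (ℤ × ℤ) × (ℤ × ℤ) | pairDet x.1 x.2 < 0} => invProd U V x)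
      (Real.pi ^ 3 * (riemannZeta 3).re / (2 * (U * conj V).im ^ 3)) := by
    replace hpos := (hasSum_subtype_iff_indicator (f := invProd U V)).1 hpos
    refine (hasSum_subtype_iff_indicator (f := invProd U V)).2 ?_
    rw [← (Equiv.prodComm _ _).hasSum_iff] at hpos
    refine hpos.congr_fun fun x => ?_
    simp [Set.indicator, hdet, invProd_swap]
  have hd : Disjoint {x : (ℤ × ℤ) × (ℤ × ℤ) | 0 < pairDet x.1 x.2}
      {x | pairDet x.1 x.2 < 0} :=
    Set.disjoint_left.2 fun x hx hx' => lt_asymm (a := (0 : ℤ)) hx hx'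
  have key := HasSum.add_disjoint (f := invProd U V) hd hpos hneg
  have hset : {x : (ℤ × ℤ) × (ℤ × ℤ) | 0 < pairDet x.1 x.2} ∪ {x | pairDet x.1 x.2 < 0} =
      {x | pairDet x.1 x.2 ≠ 0} := by
    ext x
    simp only [Set.mem_union, Set.mem_ofPred_eq]
    omega
  have hval (s t : ℝ) : s / (2 * t) + s / (2 * t) = s / t := by
    rw [← add_div, ← two_mul, mul_div_mul_left _ _ two_ne_zero]
  rwa [hset, hval] at key

/-! ### The sum over collinear pairs -/

/-- For collinear vectors `u` and `v` this is the cube of `± 1 / (‖u‖ ‖v‖)`, with the sign of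
their inner product. -/
noncomputable def collinearCube (U V : ℂ) (x : (ℤ × ℤ) × (ℤ × ℤ)) : ℝ :=
  if pairDet x.1 x.2 = 0 then
    ((vec U V x.1 * conj (vec U V x.2)).re / (normSq (vec U V x.1) * normSq (vec U V x.2))) ^ 3
  else 0

/-- The summand `1 / ‖v‖⁶`, placed at the pairs `(0, v)`. -/
noncomputable def degenerateTerm (U V : ℂ) (x : (ℤ × ℤ) × (ℤ × ℤ)) : ℝ :=
  if x.1 = 0 then (normSq (vec U V x.2) ^ 3)⁻¹ else 0

/-- The rotation `(ω₁, ω₂, ω₃) ↦ (ω₂, ω₃, ω₁)` of the triples of sum zero. -/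
def rotate : (ℤ × ℤ) × (ℤ × ℤ) ≃ (ℤ × ℤ) × (ℤ × ℤ) where
  toFun x := (x.2, -x.1 - x.2)
  invFun x := (-x.1 - x.2, x.1)
  left_inv x := by ext <;> simp <;> ring
  right_inv x := by ext <;> simp

lemma sum_inner_cube {a b D : ℝ} (ha : a ≠ 0) (hb : b ≠ 0) (hc : a + b + 2 * D ≠ 0)
    (hD : D ^ 2 = a * b) :
    (D / (a * b)) ^ 3 + ((-D - b) / (b * (a + b + 2 * D))) ^ 3 +
      ((-a - D) / ((a + b + 2 * D) * a)) ^ 3 = 3 * (a * b * (a + b + 2 * D))⁻¹ := by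
  obtain ⟨c, hc'⟩ : ∃ c, c = a + b + 2 * D := ⟨_, rfl⟩
  rw [← hc'] at hc ⊢
  have hsum : D / (a * b) + (-D - b) / (b * c) + (-a - D) / (c * a) = 0 := by
    field_simp
    rw [hc']
    linear_combination 2 * hD
  have hprod : D / (a * b) * ((-D - b) / (b * c)) * ((-a - D) / (c * a)) = (a * b * c)⁻¹ := by
    field_simp
    rw [hc']
    linear_combination (a + b + D) * hD
  rw [← hprod]
  -- `x + y + z = 0` gives `x³ + y³ + z³ = 3 x y z`
  linear_combination ((D / (a * b)) ^ 2 + ((-D - b) / (b * c)) ^ 2 + ((-a - D) / (c * a)) ^ 2 -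
    D / (a * b) * ((-D - b) / (b * c)) - (-D - b) / (b * c) * ((-a - D) / (c * a)) -
    (-a - D) / (c * a) * (D / (a * b))) * hsum

/-- The summand over collinear triples, averaged over rotations of cubes whose sum vanishes. -/
lemma collinear_invProd_eq {U V : ℂ} (h : 0 < (U * conj V).im) (x : (ℤ × ℤ) × (ℤ × ℤ)) :
    {x : (ℤ × ℤ) × (ℤ × ℤ) | pairDet x.1 x.2 = 0}.indicator (invProd U V) x =
      3⁻¹ * ((collinearCube U V x + degenerateTerm U V x) +
        (collinearCube U V (rotate x) + degenerateTerm U V (rotate x)) +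
        (collinearCube U V (rotate (rotate x)) + degenerateTerm U V (rotate (rotate x)))) := by
  obtain ⟨p, q⟩ := x
  have d1 : pairDet q (-p - q) = pairDet p q := by simp [pairDet]; ring
  have d2 : pairDet (-p - q) p = pairDet p q := by simp [pairDet]; ring
  have hrr : -q - (-p - q) = p := by abel
  simp only [Set.indicator, Set.mem_ofPred_eq, collinearCube, degenerateTerm, rotate,
    Equiv.coe_fn_mk, d1, d2, hrr, invProd]
  have cube {r : ℂ} : ((-(r.im * r.im) + -(r.re * r.re)) / (normSq r * normSq r)) ^ 3 =
      -(normSq r ^ 3)⁻¹ := by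
    rw [show -(r.im * r.im) + -(r.re * r.re) = -normSq r by rw [normSq_apply]; ring]
    rcases eq_or_ne (normSq r) 0 with h0 | h0
    · simp [h0]
    · field_simp
  by_cases hd : pairDet p q = 0
  · simp only [hd, if_true]
    rcases eq_or_ne p 0 with rfl | hp
    · rcases eq_or_ne q 0 with rfl | hq
      · simp
      · simp [vec_neg, hq, cube]
    rcases eq_or_ne q 0 with rfl | hq
    · simp [vec_neg, hp, cube]
    rcases eq_or_ne (-p - q) 0 with hpq | hpq
    · obtain rfl : q = -p := by rw [sub_eq_zero] at hpq; exact hpq.symm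
      simp [vec_neg, hp, cube]
    have ne {r : ℤ × ℤ} (hr : r ≠ 0) : normSq (vec U V r) ≠ 0 := normSq_eq_zero.not.2
      (vec_ne_zero h hr)
    have e0 : vec U V (-p - q) = -vec U V (p + q) := by rw [← vec_neg]; congr 1; abel
    have hpq' : p + q ≠ 0 := by
      rintro h0
      exact hpq (by rw [← neg_add', h0, neg_zero])
    have e3 : normSq (vec U V (p + q)) = normSq (vec U V p) + normSq (vec U V q) +
        2 * (vec U V p * conj (vec U V q)).re := by
      rw [vec_add, normSq_add]
    have e1 : (vec U V q * conj (-vec U V (p + q))).re =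
        -(vec U V p * conj (vec U V q)).re - normSq (vec U V q) := by
      rw [vec_add, normSq_apply]; simp; ring
    have e2 : (-vec U V (p + q) * conj (vec U V p)).re =
        -normSq (vec U V p) - (vec U V p * conj (vec U V q)).re := by
      rw [vec_add, normSq_apply]; simp; ring
    have hD : (vec U V p * conj (vec U V q)).re ^ 2 =
        normSq (vec U V p) * normSq (vec U V q) := by
      have him := im_vec_mul_conj_vec U V p q
      rw [hd, Int.cast_zero, zero_mul] at him
      rw [← normSq_conj (vec U V q), ← normSq_mul, normSq_apply, him]
      ring
    simp only [hp, hq, hpq, if_false, add_zero, e0, normSq_neg, e1, e2]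
    have hc := ne hpq'
    rw [e3] at hc ⊢
    rw [sum_inner_cube (ne hp) (ne hq) hc hD]
    ring
  · have hp : p ≠ 0 := by rintro rfl; simp [pairDet] at hd
    have hq : q ≠ 0 := by rintro rfl; simp [pairDet] at hd
    have hpq : -p - q ≠ 0 := by
      intro h0
      rw [sub_eq_zero] at h0
      subst h0
      exact hd (by simp [pairDet]; ring)
    simp [hd, hp, hq, hpq]

lemma summable_collinearCube {U V : ℂ} (h : 0 < (U * conj V).im) :
    Summable (collinearCube U V) := by
  refine Summable.of_norm_bounded (summable_inv_norm_vec_mul h) fun x => ?_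
  rw [collinearCube]
  split_ifs with hd
  · rw [Real.norm_eq_abs, abs_pow, ← mul_inv, ← mul_pow, ← inv_pow]
    gcongr
    have hre : |(vec U V x.1 * conj (vec U V x.2)).re| ≤ ‖vec U V x.1‖ * ‖vec U V x.2‖ := by
      simpa using abs_re_le_norm (vec U V x.1 * conj (vec U V x.2))
    rw [abs_div, normSq_eq_norm_sq, normSq_eq_norm_sq, ← mul_pow, abs_sq, inv_eq_one_div]
    rcases (mul_nonneg (norm_nonneg (vec U V x.1)) (norm_nonneg (vec U V x.2))).eq_or_lt with h0 | h0
    · simp [← h0]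
    · rw [div_le_div_iff₀ (by positivity) h0, one_mul, sq]
      gcongr
  · rw [norm_zero]; positivity

/-- The substitution `v ↦ -v` in the second vector changes the sign. -/
lemma hasSum_collinearCube {U V : ℂ} (h : 0 < (U * conj V).im) :
    HasSum (collinearCube U V) 0 := by
  have e := ((Equiv.refl (ℤ × ℤ)).prodCongr (Equiv.neg (ℤ × ℤ))).tsum_eq (collinearCube U V)
  have hneg (x : (ℤ × ℤ) × (ℤ × ℤ)) :
      collinearCube U V (((Equiv.refl (ℤ × ℤ)).prodCongr (Equiv.neg (ℤ × ℤ))) x) =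
        -collinearCube U V x := by
    have hd : pairDet x.1 (-x.2) = 0 ↔ pairDet x.1 x.2 = 0 := by
      rw [show pairDet x.1 (-x.2) = -pairDet x.1 x.2 by simp [pairDet]; ring, neg_eq_zero]
    simp only [collinearCube, Equiv.prodCongr_apply, Prod.map_fst, Prod.map_snd, Equiv.refl_apply,
      Equiv.neg_apply, hd, vec_neg, map_neg, mul_neg, neg_re, normSq_neg]
    split_ifs <;> ring
  rw [tsum_congr hneg, tsum_neg] at e
  have h0 : ∑' x, collinearCube U V x = 0 := by linarith
  rw [← h0]
  exact (summable_collinearCube h).hasSum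

lemma summable_inv_normSq_vec_pow_three {U V : ℂ} (h : 0 < (U * conj V).im) :
    Summable fun p : ℤ × ℤ => (normSq (vec U V p) ^ 3)⁻¹ := by
  have hs := summable_inv_norm_vec_pow_three h
  have := hs.mul_of_nonneg hs (fun _ => by positivity) (fun _ => by positivity)
  refine (this.comp_injective (i := fun p => (p, p)) fun p q e => (Prod.ext_iff.1 e).1).congr
    fun p => ?_
  simp only [Function.comp_apply, normSq_eq_norm_sq, ← mul_inv]
  ring

/-- The sum over all pairs of determinant zero. -/
lemma hasSum_invProd_pairDet_eq_zero {U V : ℂ} (h : 0 < (U * conj V).im) :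
    HasSum (fun x : {x : (ℤ × ℤ) × (ℤ × ℤ) | pairDet x.1 x.2 = 0} => invProd U V x)
      (∑' p, (normSq (vec U V p) ^ 3)⁻¹) := by
  have hdeg : HasSum (degenerateTerm U V) (∑' p, (normSq (vec U V p) ^ 3)⁻¹) := by
    have hinj : Function.Injective fun q : ℤ × ℤ => ((0 : ℤ × ℤ), q) :=
      fun p q e => (Prod.ext_iff.1 e).2
    rw [← hinj.hasSum_iff]
    · simpa [Function.comp_def, degenerateTerm] using (summable_inv_normSq_vec_pow_three h).hasSum
    · intro x hx
      exact if_neg fun h0 => hx ⟨x.2, Prod.ext h0.symm rfl⟩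
  have h0 := (hasSum_collinearCube h).add hdeg
  have h1 := rotate.hasSum_iff.2 h0
  have h2 := rotate.hasSum_iff.2 h1
  have key := ((h0.add h1).add h2).mul_left 3⁻¹
  refine (hasSum_subtype_iff_indicator (f := invProd U V)).2 ?_
  have hval (s : ℝ) : 3⁻¹ * ((0 + s) + (0 + s) + (0 + s)) = s := by ring
  rw [hval] at key
  exact key.congr_fun fun x => collinear_invProd_eq h x

/-! ### Triples of lattice vectors -/

lemma im_coe_mul_conj_one (z : UpperHalfPlane) : ((z : ℂ) * conj 1).im = z.im := by
  simp

lemma im_coe_mul_conj_one_pos (z : UpperHalfPlane) : 0 < ((z : ℂ) * conj 1).im := by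
  rw [im_coe_mul_conj_one]; exact z.im_pos

lemma vec_coe_one (z : UpperHalfPlane) (p : ℤ × ℤ) : vec z 1 p = p.1 * (z : ℂ) + p.2 := by
  simp [vec]

lemma vec_coe_one_eq_zero_iff (z : UpperHalfPlane) (p : ℤ × ℤ) : vec z 1 p = 0 ↔ p = 0 :=
  ⟨fun h => by_contra fun hp => vec_ne_zero (im_coe_mul_conj_one_pos z) hp h,
    fun h => by rw [h, vec_zero]⟩

lemma vec_coe_one_injective (z : UpperHalfPlane) : Function.Injective (vec z 1) := by
  intro p q h
  have : vec z 1 (p + -q) = 0 := by rw [vec_add, vec_neg, h, add_neg_cancel]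
  rw [vec_coe_one_eq_zero_iff, ← sub_eq_add_neg, sub_eq_zero] at this
  exact this

lemma mem_lattice_iff (z : UpperHalfPlane) (ω : ℂ) : ω ∈ lattice z ↔ ∃ p, vec z 1 p = ω := by
  constructor
  · rintro ⟨m, n, rfl⟩
    exact ⟨(m, n), vec_coe_one z _⟩
  · rintro ⟨p, rfl⟩
    exact ⟨p.1, p.2, vec_coe_one z p⟩

/-- The triple of lattice vectors of sum zero with first two members given by `x`. -/
def tripleOf (z : UpperHalfPlane) (x : (ℤ × ℤ) × (ℤ × ℤ)) : ℂ × ℂ × ℂ :=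
  (vec z 1 x.1, vec z 1 x.2, -vec z 1 (x.1 + x.2))

lemma tripleOf_injective (z : UpperHalfPlane) : Function.Injective (tripleOf z) := by
  intro x y h
  simp only [tripleOf, Prod.mk.injEq] at h
  exact Prod.ext (vec_coe_one_injective z h.1) (vec_coe_one_injective z h.2.1)

/-- The pairs which, completed to a triple of sum zero, consist of nonzero vectors. -/
def nonzeroPairs : Set ((ℤ × ℤ) × (ℤ × ℤ)) := {x | x.1 ≠ 0 ∧ x.2 ≠ 0 ∧ x.1 + x.2 ≠ 0}

lemma tripleOf_mem_triples_iff (z : UpperHalfPlane) (x : (ℤ × ℤ) × (ℤ × ℤ)) :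
    tripleOf z x ∈ triples z ↔ x ∈ nonzeroPairs := by
  have hm (p : ℤ × ℤ) : vec z 1 p ∈ lattice z := (mem_lattice_iff z _).2 ⟨p, rfl⟩
  have hm' : -vec z 1 (x.1 + x.2) ∈ lattice z := by rw [← vec_neg]; exact hm _
  have hs : vec z 1 x.1 + vec z 1 x.2 + -vec z 1 (x.1 + x.2) = 0 := by rw [vec_add]; ring
  simp only [triples, tripleOf, nonzeroPairs, Set.mem_ofPred_eq, hm, hm', hs, neg_ne_zero, ne_eq,
    vec_coe_one_eq_zero_iff, and_true, true_and]

lemma exists_tripleOf_eq {z : UpperHalfPlane} {t : ℂ × ℂ × ℂ} (ht : t ∈ triples z) :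
    ∃ x, tripleOf z x = t := by
  obtain ⟨⟨h1, h2, -⟩, -, hs⟩ := ht
  obtain ⟨p, hp⟩ := (mem_lattice_iff z _).1 h1
  obtain ⟨q, hq⟩ := (mem_lattice_iff z _).1 h2
  refine ⟨(p, q), Prod.ext hp (Prod.ext hq ?_)⟩
  simp only [tripleOf, vec_add, hp, hq]
  exact (eq_neg_of_add_eq_zero_right hs).symm

lemma collinear_zero_iff {u v : ℂ} (hu : u ≠ 0) :
    Collinear ℝ ({0, u, v, -(u + v)} : Set ℂ) ↔ (u * conj v).im = 0 := by
  rw [collinear_iff_of_mem (p₀ := (0 : ℂ)) (by simp)]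
  constructor
  · rintro ⟨d, hd⟩
    obtain ⟨r, hr⟩ := hd u (by simp)
    obtain ⟨s, hs⟩ := hd v (by simp)
    rw [hr, hs]
    simp
    ring
  · intro h
    refine ⟨u, ?_⟩
    have hv : v = ((u * conj v).re / normSq u) • u := by
      have hn : (normSq u : ℂ) ≠ 0 := by exact_mod_cast normSq_eq_zero.not.2 hu
      have hreal : u * conj v = ((u * conj v).re : ℝ) := Complex.ext rfl (by simpa using h)
      have hreal' : conj u * v = ((u * conj v).re : ℝ) := by
        have := congrArg conj hreal
        rwa [map_mul, conj_conj, conj_ofReal] at this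
      rw [real_smul, ofReal_div, ← hreal', ← mul_conj]
      have := (map_ne_zero (starRingEnd ℂ)).2 hu
      field_simp
    generalize (u * conj v).re / normSq u = r at hv
    simp only [Set.mem_insert_iff, Set.mem_singleton_iff, vadd_eq_add, add_zero, forall_eq_or_imp,
      forall_eq]
    refine ⟨⟨0, by simp⟩, ⟨1, by simp⟩, ⟨r, hv⟩, ⟨-(1 + r), ?_⟩⟩
    rw [hv]
    module

lemma isCollinear_tripleOf_iff (z : UpperHalfPlane) {x : (ℤ × ℤ) × (ℤ × ℤ)} (hx : x.1 ≠ 0) :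
    IsCollinear (tripleOf z x) ↔ pairDet x.1 x.2 = 0 := by
  have hu : vec z 1 x.1 ≠ 0 := (vec_coe_one_eq_zero_iff z _).not.2 hx
  simp only [IsCollinear, tripleOf, vec_add]
  rw [collinear_zero_iff hu, im_vec_mul_conj_vec, im_coe_mul_conj_one, mul_eq_zero,
    or_iff_left z.im_ne_zero, Int.cast_eq_zero]

lemma term_tripleOf (z : UpperHalfPlane) (x : (ℤ × ℤ) × (ℤ × ℤ)) :
    term z (tripleOf z x) = z.im ^ 3 * invProd z 1 x := by
  simp only [term, tripleOf, invProd, normSq_eq_norm_sq, norm_mul, norm_neg, mul_pow,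
    div_eq_mul_inv]

lemma invProd_eq_zero_of_notMem {U V : ℂ} {x : (ℤ × ℤ) × (ℤ × ℤ)} (hx : x ∉ nonzeroPairs) :
    invProd U V x = 0 := by
  by_contra h
  refine hx ⟨?_, ?_, ?_⟩ <;> intro h0 <;> exact h (by simp [invProd, h0])

/-- A sum over a set of triples is a sum over the corresponding pairs of coordinate vectors; the
pairs with a vanishing member contribute nothing. -/
lemma hasSum_term_of_hasSum_invProd {z : UpperHalfPlane} {s : Set (ℂ × ℂ × ℂ)}
    {P : Set ((ℤ × ℤ) × (ℤ × ℤ))} (hs : s ⊆ triples z)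
    (hP : ∀ x ∈ nonzeroPairs, tripleOf z x ∈ s ↔ x ∈ P) {a : ℝ}
    (h : HasSum (fun x : P => invProd z 1 x) a) :
    HasSum (fun t : s => term z t) (z.im ^ 3 * a) := by
  have hs' : s = tripleOf z '' (P ∩ nonzeroPairs) := by
    ext t
    constructor
    · intro ht
      obtain ⟨x, rfl⟩ := exists_tripleOf_eq (hs ht)
      have hx := (tripleOf_mem_triples_iff z x).1 (hs ht)
      exact ⟨x, ⟨(hP x hx).1 ht, hx⟩, rfl⟩
    · rintro ⟨x, ⟨hx, hx'⟩, rfl⟩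
      exact (hP x hx').2 hx
  subst hs'
  refine (Equiv.Set.image (tripleOf z) (P ∩ nonzeroPairs) (tripleOf_injective z)).hasSum_iff.1 ?_
  have h1 := (hasSum_subtype_iff_indicator (f := invProd z 1)).1 h
  have h2 : HasSum (fun x : (P ∩ nonzeroPairs : Set _) => invProd z 1 x) a := by
    refine (hasSum_subtype_iff_indicator (f := invProd z 1)).2 (h1.congr_fun fun x => ?_)
    by_cases hx : x ∈ nonzeroPairs
    · by_cases hxP : x ∈ P
      · rw [Set.indicator_of_mem (Set.mem_inter hxP hx), Set.indicator_of_mem hxP]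
      · rw [Set.indicator_of_notMem fun h => hxP h.1, Set.indicator_of_notMem hxP]
    · simp [Set.indicator, invProd_eq_zero_of_notMem hx]
  exact (h2.mul_left (z.im ^ 3)).congr_fun fun x => term_tripleOf z x

lemma eisensteinTerm_three (z : UpperHalfPlane) (p : ℤ × ℤ) :
    eisensteinTerm z 3 p = ((z.im ^ 3 * (normSq (vec z 1 p) ^ 3)⁻¹ : ℝ) : ℂ) := by
  have e : (2 * 3 : ℂ) = ((6 : ℕ) : ℂ) := by norm_num
  have e' : (3 : ℂ) = ((3 : ℕ) : ℂ) := by norm_num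
  rw [eisensteinTerm, e, e', cpow_natCast, cpow_natCast, vec_coe_one, normSq_eq_norm_sq, ← pow_mul]
  push_cast
  rw [div_eq_mul_inv]

lemma hasSum_eisensteinTerm_three (z : UpperHalfPlane) :
    HasSum (fun p : {p : ℤ × ℤ // p ≠ (0, 0)} => eisensteinTerm z 3 (p : ℤ × ℤ))
      ((z.im ^ 3 * ∑' p, (normSq (vec z 1 p) ^ 3)⁻¹ : ℝ) : ℂ) := by
  have h := ((summable_inv_normSq_vec_pow_three (im_coe_mul_conj_one_pos z)).hasSum).mul_left
    (z.im ^ 3)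
  have h' : HasSum (fun p : {p : ℤ × ℤ // p ≠ (0, 0)} =>
      z.im ^ 3 * (normSq (vec z 1 p) ^ 3)⁻¹) (z.im ^ 3 * ∑' p, (normSq (vec z 1 p) ^ 3)⁻¹) := by
    refine (Subtype.val_injective.hasSum_iff (f := fun p : ℤ × ℤ =>
      z.im ^ 3 * (normSq (vec z 1 p) ^ 3)⁻¹) fun p hp => ?_).2 h
    obtain rfl : p = 0 := by
      have : p = (0, 0) := by simpa using hp
      exact this
    simp
  exact (hasSum_ofReal.2 h').congr_fun fun p => eisensteinTerm_three z p

lemma ofReal_re_riemannZeta_three : ((riemannZeta 3).re : ℂ) = riemannZeta 3 := by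
  have h := zeta_nat_eq_tsum_of_gt_one (k := 3) (by norm_num)
  have : riemannZeta 3 = ((∑' n : ℕ, 1 / (n : ℝ) ^ 3 : ℝ) : ℂ) := by
    rw [ofReal_tsum]
    push_cast at h ⊢
    exact h
  rw [this, ofReal_re]

end LatticeSum

theorem mainTheorem5 (z : UpperHalfPlane) :
    Summable (fun t : LatticeSum.triples z => LatticeSum.term z (t : ℂ × ℂ × ℂ)) ∧
    Summable (fun p : {p : ℤ × ℤ // p ≠ (0, 0)} =>
      LatticeSum.eisensteinTerm z 3 (p : ℤ × ℤ)) ∧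
    (LatticeSum.D111 z : ℂ) =
      2 * LatticeSum.eisenstein z 3 + (Real.pi : ℂ) ^ 3 * riemannZeta 3 ∧
    ((∑' t : LatticeSum.collinearTriples z, LatticeSum.term z (t : ℂ × ℂ × ℂ) : ℝ) : ℂ) =
      2 * LatticeSum.eisenstein z 3 ∧
    ((∑' t : LatticeSum.nonCollinearTriples z, LatticeSum.term z (t : ℂ × ℂ × ℂ) : ℝ) : ℂ) =
      (Real.pi : ℂ) ^ 3 * riemannZeta 3 := by
  have hz := LatticeSum.im_coe_mul_conj_one_pos z
  have hcol := LatticeSum.hasSum_term_of_hasSum_invProd (z := z)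
    (s := LatticeSum.collinearTriples z) (fun _ ht => ht.1)
    (fun x hx => (and_iff_right ((LatticeSum.tripleOf_mem_triples_iff z x).2 hx)).trans
      (LatticeSum.isCollinear_tripleOf_iff z hx.1))
    (LatticeSum.hasSum_invProd_pairDet_eq_zero hz)
  have hnon := LatticeSum.hasSum_term_of_hasSum_invProd (z := z)
    (s := LatticeSum.nonCollinearTriples z) (fun _ ht => ht.1)
    (fun x hx => (and_iff_right ((LatticeSum.tripleOf_mem_triples_iff z x).2 hx)).trans
      (LatticeSum.isCollinear_tripleOf_iff z hx.1).not)
    (LatticeSum.hasSum_invProd_pairDet_ne_zero hz)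
  have hE := LatticeSum.hasSum_eisensteinTerm_three z
  have hE' : 2 * LatticeSum.eisenstein z 3 =
      ((z.im ^ 3 * ∑' p, (Complex.normSq (LatticeSum.vec z 1 p) ^ 3)⁻¹ : ℝ) : ℂ) := by
    rw [LatticeSum.eisenstein, hE.tsum_eq, ← mul_assoc]
    norm_num
  have hζ : ((z.im ^ 3 * (Real.pi ^ 3 * (riemannZeta 3).re / ((z : ℂ) * star 1).im ^ 3) : ℝ) : ℂ) =
      (Real.pi : ℂ) ^ 3 * riemannZeta 3 := by
    have : z.im ^ 3 * (Real.pi ^ 3 * (riemannZeta 3).re / ((z : ℂ) * star 1).im ^ 3) =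
        Real.pi ^ 3 * (riemannZeta 3).re := by
      have hy := z.im_ne_zero
      rw [show ((z : ℂ) * star 1).im = z.im from LatticeSum.im_coe_mul_conj_one z]
      field_simp
    rw [this, Complex.ofReal_mul, Complex.ofReal_pow, LatticeSum.ofReal_re_riemannZeta_three]
  have hdisj : Disjoint (LatticeSum.collinearTriples z) (LatticeSum.nonCollinearTriples z) :=
    Set.disjoint_left.2 fun _ h h' => h'.2 h.2
  have hunion : LatticeSum.collinearTriples z ∪ LatticeSum.nonCollinearTriples z =
      LatticeSum.triples z := by
    ext t
    constructor
    · rintro (h | h) <;> exact h.1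
    · exact fun h => (em (LatticeSum.IsCollinear t)).imp (fun hc => ⟨h, hc⟩) fun hc => ⟨h, hc⟩
  have hall := HasSum.add_disjoint (f := LatticeSum.term z) hdisj hcol hnon
  rw [hunion] at hall
  refine ⟨hall.summable, hE.summable, ?_, ?_, ?_⟩
  · have : LatticeSum.D111 z = _ := hall.tsum_eq
    rw [this, Complex.ofReal_add, hE', ← hζ]
    rfl
  · rw [hcol.tsum_eq, hE']
  · rw [hnon.tsum_eq, ← hζ]
    rfl
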